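/- **Theorem (Convexity).** Let $\Phi:[0,\infty)\to\mathbb R$ (the cycle stress function) be convex and nondecreasing with $\Phi(0)=0$. For a profile $\mathbf x=(x_1,\dots,x_n)\in\mathbb R^n$, the rainflow algorithm works as follows. Let $s_1,s_2,\dots,s_N$ be the successive local extrema of $\mathbf x$ (the first and last points included, plateaus counted once). Going through the sequence from left to right, whenever four successive remaining points $a,b,c,d$ satisfy $|b-c|\le|a-b|$ and $|b-c|\le|c-d|$, a full cycle, that is, one charging and one discharging half cycle, each of depth $|b-c|$, is extracted, the points $b$ and $c$ are deleted, and the rest is joined. When no such quadruple is left, every two consecutive remaining points form one half cycle, charging if the value increases and discharging if it decreases, whose depth is the absolute difference. Let $\mathbf v$ and $\mathbf w$ be the lists of depths of all charging and all discharging half cycles, $(\mathbf v,\mathbf w)=\mathrm{Rainflow}(\mathbf x)$, and $$f(\mathbf x)=\sum_{i=1}^{|\mathbf v|}\frac{\Phi(v_i)}2+\sum_{j=1}^{|\mathbf w|}\frac{\Phi(w_j)}2 .$$ 1. For every $n$, the function $f:\mathbb R^n\to\mathbb R$ is convex: $f(\lambda\mathbf x+(1-\lambda)\mathbf y)\le\lambda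 f(\mathbf x)+(1-\lambda)f(\mathbf y)$ for all $\mathbf x,\mathbf y\in\mathbb R^n$ and $\lambda\in[0,1]$. 2. Let $T\in\mathbb N$, $\tau,E,\eta_c,\eta_d>0$, $B,\theta,\pi\ge0$, $P,x_0,\underline x,\overline x\in\mathbb R$ and $\mathbf r\in\mathbb R^T$ be given. For $\mathbf c,\mathbf d\in\mathbb R^T$ let $$x_t=x_{t-1}+\frac{\tau\eta_c}{E}c_t-\frac{\tau}{\eta_dE}d_t,\qquad t=1,\dots,T .$$ Then the degradation cost $f(\mathbf x)\,B\,E$ is a convex function of $(\mathbf c,\mathbf d)\in\mathbb R^T\times\mathbb R^T$, and the offline battery control problem $$\min_{\mathbf c,\mathbf d}\ \tau\sum_{t=1}^T\Big[\theta\Big|\eta_cc_t-\frac{d_t}{\eta_d}-r_t\Big|^++\pi\Big|r_t-\eta_cc_t+\frac{d_t}{\eta_d}\Big|^+\Big]+f(\mathbf x)\,B\,E$$ $$\text{subject to}\quad \underline x\le x_t\le\overline x,\quad 0\le c_t\le P,\quad 0\le d_t\le P\qquad(t=1,\dots,T)$$ is a convex program in the variables $(\mathbf c,\mathbf d)$: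 its feasible set is convex and its objective is a convex function on $\mathbb R^T\times\mathbb R^T$. Here $|u|^+=\max(u,0)$. This holds both when the cycles are counted in $\mathbf x=(x_1,\dots,x_T)$ and when they are counted in $\mathbf x=(x_0,x_1,\dots,x_T)$. -/

import Mathlib

/-! Rainflow cycle counting, the rainflow cycle-based degradation cost,
and the offline battery control problem. -/

namespace Rainflow

/-- Auxiliary recursion for `turningPoints`: `turningPointsFrom a l` lists the local extrema of
the sequence `a :: l`, given that its first point `a` is kept. A point `b` between its neighbours
`a` and `c` (in the weak sense) is dropped, so plateaus are collapsed to a single point. -/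
noncomputable def turningPointsFrom (a : ℝ) : List ℝ → List ℝ
  | [] => [a]
  | [b] => if a = b then [a] else [a, b]
  | b :: c :: l =>
      if (a ≤ b ∧ b ≤ c) ∨ (c ≤ b ∧ b ≤ a) then turningPointsFrom a (c :: l)
      else a :: turningPointsFrom b (c :: l)

/-- The successive local extrema `s₁, s₂, …` of a profile; its first and last point count as
extrema. -/
noncomputable def turningPoints : List ℝ → List ℝ
  | [] => []
  | a :: l => turningPointsFrom a l

/-- The four-point test, repeated. The list holds the points kept so far, latest first, and `d` is
the next point. While the latest four points `a, b, c, d` satisfy `|b - c| ≤ |a - b|` and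
`|b - c| ≤ |c - d|`, the full cycle `b`-`c` is extracted and the points `b`, `c` are discarded.
Returns the depths of the extracted full cycles and the points kept, latest first. -/
noncomputable def extract (d : ℝ) : List ℝ → List ℝ × List ℝ
  | c :: b :: a :: l =>
      if |b - c| ≤ |a - b| ∧ |b - c| ≤ |c - d| then
        (|b - c| :: (extract d (a :: l)).1, (extract d (a :: l)).2)
      else ([], d :: c :: b :: a :: l)
  | l => ([], d :: l)

/-- `scan kept s` processes the points of `s` one after the other, starting from the points `kept`
(latest first). Returns the depths of all full cycles extracted and the residue, latest first. -/
noncomputable def scan : List ℝ → List ℝ → List ℝ × List ℝ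
  | kept, [] => ([], kept)
  | kept, d :: s =>
      ((extract d kept).1 ++ (scan (extract d kept).2 s).1, (scan (extract d kept).2 s).2)

/-- Depths of the charging half cycles between consecutive points of the residue. -/
noncomputable def chargingSteps : List ℝ → List ℝ
  | a :: b :: l => if a < b then (b - a) :: chargingSteps (b :: l) else chargingSteps (b :: l)
  | _ => []

/-- Depths of the discharging half cycles between consecutive points of the residue. -/
noncomputable def dischargingSteps : List ℝ → List ℝ
  | a :: b :: l => if b < a then (a - b) :: dischargingSteps (b :: l) else dischargingSteps (b :: l)
  | _ => []

/-- Depths of the full cycles of a profile. -/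
noncomputable def fullCycles (x : List ℝ) : List ℝ := (scan [] (turningPoints x)).1

/-- The residue of a profile, in order of time. -/
noncomputable def residue (x : List ℝ) : List ℝ := (scan [] (turningPoints x)).2.reverse

/-- The rainflow counting algorithm: the depths `(v, w)` of all charging and all discharging half
cycles. A full cycle counts as one charging and one discharging half cycle. -/
noncomputable def rainflow (x : List ℝ) : List ℝ × List ℝ :=
  (fullCycles x ++ chargingSteps (residue x), fullCycles x ++ dischargingSteps (residue x))

/-- The rainflow cycle-based degradation cost `∑ᵢ Φ(vᵢ)/2 + ∑ⱼ Φ(wⱼ)/2` of a profile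
`x₁, …, xₙ`, where `(v, w)` is the output of the rainflow algorithm. -/
noncomputable def cost (Φ : ℝ → ℝ) {n : ℕ} (x : Fin n → ℝ) : ℝ :=
  ((rainflow (List.ofFn x)).1.map fun v => Φ v / 2).sum +
    ((rainflow (List.ofFn x)).2.map fun w => Φ w / 2).sum

end Rainflow

/-- The data of the battery control problem over `T` time steps. -/
structure BatteryProblem (T : ℕ) where
  /-- duration of a time step -/
  τ : ℝ
  /-- rated energy capacity -/
  E : ℝ
  /-- charging efficiency -/
  ηc : ℝ
  /-- discharging efficiency -/
  ηd : ℝ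
  /-- cell replacement unit cost -/
  B : ℝ
  /-- power rating -/
  P : ℝ
  /-- initial state of charge -/
  x₀ : ℝ
  /-- minimum state of charge -/
  xmin : ℝ
  /-- maximum state of charge -/
  xmax : ℝ
  /-- over-response price `θ` -/
  priceOver : ℝ
  /-- under-response price `π` -/
  priceUnder : ℝ
  /-- instruction signal, known in advance in the offline problem -/
  r : Fin T → ℝ

namespace BatteryProblem

variable {T : ℕ} (p : BatteryProblem T)

/-- The state of charge `x_t`, `t = 0, …, T`, under the charging and discharging powers
`z = (c, d)`. -/
noncomputable def soc (z : (Fin T → ℝ) × (Fin T → ℝ)) (t : Fin (T + 1)) : ℝ :=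
  p.x₀ + ∑ k : Fin T, if k.castSucc < t then
    p.τ * p.ηc / p.E * z.1 k - p.τ / (p.ηd * p.E) * z.2 k else 0

theorem soc_zero (z : (Fin T → ℝ) × (Fin T → ℝ)) : p.soc z 0 = p.x₀ := by
  simp [soc]

/-- The state evolution equation. -/
theorem soc_succ (z : (Fin T → ℝ) × (Fin T → ℝ)) (t : Fin T) :
    p.soc z t.succ =
      p.soc z t.castSucc + p.τ * p.ηc / p.E * z.1 t - p.τ / (p.ηd * p.E) * z.2 t := by
  have h : ∀ k : Fin T, (if k.castSucc < t.succ then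
      p.τ * p.ηc / p.E * z.1 k - p.τ / (p.ηd * p.E) * z.2 k else 0) =
      (if k.castSucc < t.castSucc then
        p.τ * p.ηc / p.E * z.1 k - p.τ / (p.ηd * p.E) * z.2 k else 0) +
      (if k = t then p.τ * p.ηc / p.E * z.1 k - p.τ / (p.ηd * p.E) * z.2 k else 0) := by
    intro k
    rcases lt_trichotomy k t with h | h | h
    · have h1 : k.castSucc < t.succ := by simp only [Fin.lt_def] at *; simp; omega
      have h2 : k.castSucc < t.castSucc := by simpa using h
      simp [h1, h2, h.ne]
    · subst h; simp
    · have h1 : ¬ k.castSucc < t.succ := by simp only [Fin.lt_def] at *; simp; omega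
      have h2 : ¬ k.castSucc < t.castSucc := by simpa using h.le
      simp [h1, h2, h.ne']
  simp only [soc, h, Finset.sum_add_distrib, Finset.sum_ite_eq', Finset.mem_univ, if_true]
  ring

/-- The profile `(x_1, …, x_T)`. -/
noncomputable def profile (z : (Fin T → ℝ) × (Fin T → ℝ)) : Fin T → ℝ := fun t => p.soc z t.succ

/-- The constraints on `z = (c, d)`. -/
def feasible : Set ((Fin T → ℝ) × (Fin T → ℝ)) :=
  {z | ∀ t, (p.xmin ≤ p.profile z t ∧ p.profile z t ≤ p.xmax) ∧
    (0 ≤ z.1 t ∧ z.1 t ≤ p.P) ∧ (0 ≤ z.2 t ∧ z.2 t ≤ p.P)}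

/-- The penalty for not following the instruction signal. -/
noncomputable def penalty (z : (Fin T → ℝ) × (Fin T → ℝ)) : ℝ :=
  p.τ * ∑ t, (p.priceOver * max (p.ηc * z.1 t - z.2 t / p.ηd - p.r t) 0 +
    p.priceUnder * max (p.r t - p.ηc * z.1 t + z.2 t / p.ηd) 0)

/-- The cycle aging cost, with the cycles counted in the profile `(x_1, …, x_T)`. -/
noncomputable def agingCost (Φ : ℝ → ℝ) (z : (Fin T → ℝ) × (Fin T → ℝ)) : ℝ :=
  Rainflow.cost Φ (p.profile z) * p.B * p.E

/-- The cycle aging cost, with the cycles counted in the profile `(x_0, x_1, …, x_T)`. -/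
noncomputable def agingCostFromInitial (Φ : ℝ → ℝ) (z : (Fin T → ℝ) × (Fin T → ℝ)) : ℝ :=
  Rainflow.cost Φ (p.soc z) * p.B * p.E

end BatteryProblem

namespace Rainflow

/-! ### The lazy path in a tube around a profile -/

/-! On the finitely many depths that matter, `Φ` is a nonnegative combination of hinges `max (v -
2h) 0` (`exists_hinge_interpolation`), and the cost is linear in `Φ`. So it suffices to treat one
hinge.

For a hinge, twice the cost is the least total variation of a path staying within `h` of the profile
(`isLeast_two_mul_cost_hinge`). Convexity follows: a convex combination of two such paths stays
within `h` of the combined profile, and total variation is convex.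

For a given start the lazy path is optimal. Its variation ignores points that are not extrema
(`trackingCost_between`) and drops by exactly two hinges per extracted cycle (`trackingCost_cycle`),
which leaves the residue. There every step costs at least its hinge (`stepSum_le_trackingCost`).
Residue depths grow weakly, then decrease strictly, so a well-chosen start attains equality
(`exists_trackingCost_le_stepSum`). -/

/-- The point of `[x - h, x + h]` nearest to `y`. -/
noncomputable def clamp (h x y : ℝ) : ℝ := max (x - h) (min (x + h) y)

/-- The total variation of the path that starts at `y` and moves only as far as is needed to stay
within distance `h` of the successive points of the list. -/
noncomputable def trackingCost (h : ℝ) : List ℝ → ℝ → ℝ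
  | [], _ => 0
  | x :: l, y => |y - clamp h x y| + trackingCost h l (clamp h x y)

/-- The part of a depth `v` above the threshold `2 * h`. -/
noncomputable def hinge (h v : ℝ) : ℝ := max (v - 2 * h) 0

theorem hinge_nonneg (h v : ℝ) : 0 ≤ hinge h v := le_max_right _ _

theorem clamp_cases {h : ℝ} (hh : 0 ≤ h) (x y : ℝ) :
    (y < x - h ∧ clamp h x y = x - h) ∨ (x + h < y ∧ clamp h x y = x + h) ∨
      (x - h ≤ y ∧ y ≤ x + h ∧ clamp h x y = y) := by
  unfold clamp
  rcases lt_or_ge y (x - h) with h1 | h1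
  · left
    rw [min_eq_right (by linarith), max_eq_left h1.le]
    exact ⟨h1, rfl⟩
  · rcases lt_or_ge (x + h) y with h2 | h2
    · right; left
      rw [min_eq_left h2.le, max_eq_right (by linarith)]
      exact ⟨h2, rfl⟩
    · right; right
      rw [min_eq_right h2, max_eq_right h1]
      exact ⟨h1, h2, rfl⟩

theorem clamp_of_mem {h x y : ℝ} (h1 : x - h ≤ y) (h2 : y ≤ x + h) : clamp h x y = y := by
  rw [clamp, min_eq_right h2, max_eq_right h1]

theorem clamp_of_lt {h x y : ℝ} (hh : 0 ≤ h) (h1 : y ≤ x - h) : clamp h x y = x - h := by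
  rw [clamp, min_eq_right (by linarith), max_eq_left h1]

theorem clamp_of_gt {h x y : ℝ} (hh : 0 ≤ h) (h1 : x + h ≤ y) : clamp h x y = x + h := by
  rw [clamp, min_eq_left h1, max_eq_right (by linarith)]

theorem clamp_mem {h : ℝ} (hh : 0 ≤ h) (x y : ℝ) :
    x - h ≤ clamp h x y ∧ clamp h x y ≤ x + h := by
  rcases clamp_cases hh x y with ⟨_, e⟩ | ⟨_, e⟩ | ⟨_, _, e⟩ <;> rw [e] <;>
    constructor <;> linarith

/-- The nearest point of an interval lies between `y` and every point of the interval. -/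
theorem abs_sub_clamp_add {h : ℝ} (hh : 0 ≤ h) {x y y' : ℝ} (h1 : x - h ≤ y')
    (h2 : y' ≤ x + h) : |y - clamp h x y| + |clamp h x y - y'| = |y - y'| := by
  rcases clamp_cases hh x y with ⟨_, e⟩ | ⟨_, e⟩ | ⟨_, _, e⟩ <;> rw [e]
  · rw [abs_of_nonpos, abs_of_nonpos, abs_of_nonpos] <;> linarith
  · rw [abs_of_nonneg, abs_of_nonneg, abs_of_nonneg] <;> linarith
  · simp

theorem trackingCost_lipschitz {h : ℝ} (hh : 0 ≤ h) (l : List ℝ) (y y' : ℝ) :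
    trackingCost h l y ≤ |y - y'| + trackingCost h l y' := by
  induction l generalizing y y' with
  | nil => simp [trackingCost]
  | cons x l ih =>
    have h1 := ih (clamp h x y) (clamp h x y')
    have h2 := abs_sub_clamp_add hh (y := y) (clamp_mem hh x y').1 (clamp_mem hh x y').2
    have h3 := abs_sub_le y y' (clamp h x y')
    simp only [trackingCost]
    linarith

/-- The lazy path is optimal. -/
theorem trackingCost_cons_le {h : ℝ} (hh : 0 ≤ h) {x y' : ℝ} (l : List ℝ) (y : ℝ)
    (h1 : x - h ≤ y') (h2 : y' ≤ x + h) :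
    trackingCost h (x :: l) y ≤ |y - y'| + trackingCost h l y' := by
  have h3 := trackingCost_lipschitz hh l (clamp h x y) y'
  have h4 := abs_sub_clamp_add hh (y := y) h1 h2
  simp only [trackingCost]
  linarith

/-- The combination of the two lazy paths is an admissible competitor for the combined profile; the
triangle inequality bounds its variation. -/
theorem trackingCost_ofFn_convex {h : ℝ} (hh : 0 ≤ h) {a b : ℝ} (ha : 0 ≤ a) (hb : 0 ≤ b)
    (hab : a + b = 1) {n : ℕ} (x x' : Fin n → ℝ) (y y' : ℝ) :
    trackingCost h (List.ofFn (a • x + b • x')) (a * y + b * y') ≤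
      a * trackingCost h (List.ofFn x) y + b * trackingCost h (List.ofFn x') y' := by
  induction n generalizing y y' with
  | zero => simp [trackingCost]
  | succ n ih =>
    have key := ih (fun i => x i.succ) (fun i => x' i.succ) (clamp h (x 0) y) (clamp h (x' 0) y')
    have hc := clamp_mem hh (x 0) y
    have hc' := clamp_mem hh (x' 0) y'
    rw [List.ofFn_succ, List.ofFn_succ (f := x), List.ofFn_succ (f := x')]
    have hle := trackingCost_cons_le hh (x := (a • x + b • x') 0)
      (List.ofFn fun i : Fin n => (a • x + b • x') i.succ) (a * y + b * y')
      (y' := a * clamp h (x 0) y + b * clamp h (x' 0) y')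
      (by
        simp only [Pi.add_apply, Pi.smul_apply, smul_eq_mul]
        nlinarith [mul_le_mul_of_nonneg_left hc.1 ha, mul_le_mul_of_nonneg_left hc'.1 hb])
      (by
        simp only [Pi.add_apply, Pi.smul_apply, smul_eq_mul]
        nlinarith [mul_le_mul_of_nonneg_left hc.2 ha, mul_le_mul_of_nonneg_left hc'.2 hb])
    have habs : |a * y + b * y' - (a * clamp h (x 0) y + b * clamp h (x' 0) y')| ≤
        a * |y - clamp h (x 0) y| + b * |y' - clamp h (x' 0) y'| := by
      have := abs_add_le (a * (y - clamp h (x 0) y)) (b * (y' - clamp h (x' 0) y'))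
      rw [abs_mul, abs_mul, abs_of_nonneg ha, abs_of_nonneg hb] at this
      rwa [show a * y + b * y' - (a * clamp h (x 0) y + b * clamp h (x' 0) y') =
        a * (y - clamp h (x 0) y) + b * (y' - clamp h (x' 0) y') by ring]
    have e : (fun i : Fin n => (a • x + b • x') i.succ) =
        a • (fun i : Fin n => x i.succ) + b • (fun i : Fin n => x' i.succ) := rfl
    rw [e] at hle ⊢
    simp only [trackingCost] at hle ⊢
    linarith

theorem trackingCost_append_congr {h k : ℝ} {l₁ l₂ : List ℝ}
    (H : ∀ y, trackingCost h l₁ y = k + trackingCost h l₂ y) (p : List ℝ) (y : ℝ) :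
    trackingCost h (p ++ l₁) y = k + trackingCost h (p ++ l₂) y := by
  induction p generalizing y with
  | nil => exact H y
  | cons x p ih => simp only [List.cons_append, trackingCost, ih]; ring

theorem trackingCost_dup {h : ℝ} (hh : 0 ≤ h) (a : ℝ) (l : List ℝ) (y : ℝ) :
    trackingCost h (a :: a :: l) y = trackingCost h (a :: l) y := by
  have := clamp_mem hh a y
  simp only [trackingCost, clamp_of_mem this.1 this.2, sub_self, abs_zero, zero_add]

/-- Points between their neighbours do not matter. -/
theorem trackingCost_between {h : ℝ} (hh : 0 ≤ h) {a b c : ℝ}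
    (hb : (a ≤ b ∧ b ≤ c) ∨ (c ≤ b ∧ b ≤ a)) (l : List ℝ) (y : ℝ) :
    trackingCost h (a :: b :: c :: l) y = trackingCost h (a :: c :: l) y := by
  simp only [trackingCost]
  obtain ⟨m1, m2⟩ := clamp_mem hh a y
  set u := clamp h a y
  -- It is enough that passing through `b` changes neither the position reached at `c` nor the
  -- distance travelled.
  suffices H : clamp h c (clamp h b u) = clamp h c u ∧
      |u - clamp h b u| + |clamp h b u - clamp h c u| = |u - clamp h c u| by
    rw [H.1]; linarith [H.2]
  rcases hb with ⟨h1, h2⟩ | ⟨h1, h2⟩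
  · rcases le_or_gt u (b - h) with h3 | h3
    · rw [clamp_of_lt hh h3, clamp_of_lt hh (show b - h ≤ c - h by linarith),
        clamp_of_lt hh (show u ≤ c - h by linarith)]
      refine ⟨rfl, ?_⟩
      rw [abs_of_nonpos, abs_of_nonpos, abs_of_nonpos] <;> linarith
    · rw [clamp_of_mem h3.le (by linarith)]; simp
  · rcases le_or_gt (b + h) u with h3 | h3
    · rw [clamp_of_gt hh h3, clamp_of_gt hh (show c + h ≤ b + h by linarith),
        clamp_of_gt hh (show c + h ≤ u by linarith)]
      refine ⟨rfl, ?_⟩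
      rw [abs_of_nonneg, abs_of_nonneg, abs_of_nonneg] <;> linarith
    · rw [clamp_of_mem (by linarith) h3.le]; simp

/-- The four-point rule: extracting a full cycle lowers the tracking cost by twice the excess of
its depth. -/
theorem trackingCost_cycle {h : ℝ} (hh : 0 ≤ h) {a b c d : ℝ}
    (H : (a < b ∧ c < b ∧ a ≤ c ∧ b ≤ d) ∨ (b < a ∧ b < c ∧ c ≤ a ∧ d ≤ b)) (l : List ℝ) (y : ℝ) :
    trackingCost h (a :: b :: c :: d :: l) y =
      2 * hinge h |b - c| + trackingCost h (a :: d :: l) y := by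
  simp only [trackingCost]
  obtain ⟨m1, m2⟩ := clamp_mem hh a y
  set u := clamp h a y
  suffices H : clamp h d (clamp h c (clamp h b u)) = clamp h d u ∧
      |u - clamp h b u| + |clamp h b u - clamp h c (clamp h b u)| +
        |clamp h c (clamp h b u) - clamp h d u| = 2 * hinge h |b - c| + |u - clamp h d u| by
    rw [H.1]; linarith [H.2]
  rcases H with ⟨h1, h2, h3, h4⟩ | ⟨h1, h2, h3, h4⟩
  · have e : |b - c| = b - c := abs_of_pos (by linarith)
    -- If the intervals of `b` and `c` overlap, any move made at `b` is on the way to `d` and none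
    -- is made at `c`. Otherwise the path goes to `b - h`, back to `c + h`, then to `d - h`: a
    -- detour of `b - c - 2h` each way.
    rcases le_or_gt (b - c) (2 * h) with h5 | h5
    · have e2 : hinge h |b - c| = 0 := by rw [e, hinge, max_eq_right]; linarith
      rw [e2]
      rcases le_or_gt u (b - h) with h6 | h6
      · rw [clamp_of_lt hh h6, clamp_of_mem (x := c) (y := b - h) (by linarith) (by linarith),
          clamp_of_lt hh (show b - h ≤ d - h by linarith),
          clamp_of_lt hh (show u ≤ d - h by linarith)]
        refine ⟨rfl, ?_⟩
        rw [abs_of_nonpos, abs_of_nonpos (a := b - h - (d - h)),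
          abs_of_nonpos (a := u - (d - h))] <;> simp <;> linarith
      · rw [clamp_of_mem h6.le (by linarith), clamp_of_mem (x := c) (by linarith) (by linarith)]
        simp
    · have e2 : hinge h |b - c| = b - c - 2 * h := by rw [e, hinge, max_eq_left]; linarith
      rw [e2, clamp_of_lt hh (show u ≤ b - h by linarith),
        clamp_of_gt hh (show c + h ≤ b - h by linarith),
        clamp_of_lt hh (show c + h ≤ d - h by linarith),
        clamp_of_lt hh (show u ≤ d - h by linarith)]
      refine ⟨rfl, ?_⟩
      rw [abs_of_nonpos, abs_of_nonneg, abs_of_nonpos, abs_of_nonpos] <;> linarith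
  · have e : |b - c| = c - b := by rw [abs_of_neg (by linarith)]; ring
    rcases le_or_gt (c - b) (2 * h) with h5 | h5
    · have e2 : hinge h |b - c| = 0 := by rw [e, hinge, max_eq_right]; linarith
      rw [e2]
      rcases le_or_gt (b + h) u with h6 | h6
      · rw [clamp_of_gt hh h6, clamp_of_mem (x := c) (y := b + h) (by linarith) (by linarith),
          clamp_of_gt hh (show d + h ≤ b + h by linarith),
          clamp_of_gt hh (show d + h ≤ u by linarith)]
        refine ⟨rfl, ?_⟩
        rw [abs_of_nonneg, abs_of_nonneg (a := b + h - (d + h)),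
          abs_of_nonneg (a := u - (d + h))] <;> simp <;> linarith
      · rw [clamp_of_mem (x := b) (by linarith) h6.le,
          clamp_of_mem (x := c) (by linarith) (by linarith)]
        simp
    · have e2 : hinge h |b - c| = c - b - 2 * h := by rw [e, hinge, max_eq_left]; linarith
      rw [e2, clamp_of_gt hh (show b + h ≤ u by linarith),
        clamp_of_lt hh (show b + h ≤ c - h by linarith),
        clamp_of_gt hh (show d + h ≤ c - h by linarith),
        clamp_of_gt hh (show d + h ≤ u by linarith)]
      refine ⟨rfl, ?_⟩
      rw [abs_of_nonneg, abs_of_nonpos, abs_of_nonneg, abs_of_nonneg] <;> linarith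

/-! ### Turning points -/

/-- Every inner point of the list is a strict local extremum. -/
def Alternating : List ℝ → Prop
  | a :: b :: c :: l => ((a < b ∧ c < b) ∨ (b < a ∧ b < c)) ∧ Alternating (b :: c :: l)
  | _ => True

theorem Alternating.tail {a : ℝ} {l : List ℝ} (H : Alternating (a :: l)) : Alternating l := by
  match l, H with
  | [], _ => trivial
  | [_], _ => trivial
  | _ :: _ :: _, H => exact H.2

theorem Alternating.of_append {p l : List ℝ} (H : Alternating (p ++ l)) : Alternating l := by
  induction p with
  | nil => exact H
  | cons a p ih => exact ih H.tail

theorem trackingCost_turningPointsFrom {h : ℝ} (hh : 0 ≤ h) (a : ℝ) (l : List ℝ) (y : ℝ) :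
    trackingCost h (turningPointsFrom a l) y = trackingCost h (a :: l) y := by
  induction a, l using turningPointsFrom.induct generalizing y with
  | case1 a => simp [turningPointsFrom]
  | case2 a => simp [turningPointsFrom, trackingCost_dup hh]
  | case3 a b hab => simp [turningPointsFrom, hab]
  | case4 a b c l hb ih =>
    rw [turningPointsFrom, if_pos hb, ih, trackingCost_between hh hb]
  | case5 a b c l hb ih =>
    rw [turningPointsFrom, if_neg hb]
    simp only [trackingCost] at ih ⊢
    rw [ih]

/-- The induction needs the last clause: the output leaves `a` in the direction in which the input
does, so a kept point is a strict extremum of the output too. -/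
theorem turningPointsFrom_alternating (a : ℝ) (l : List ℝ) :
    Alternating (turningPointsFrom a l) ∧ ∃ t, turningPointsFrom a l = a :: t ∧
      ∀ r ∈ t.head?, ∀ c ∈ l.head?, (a < c → a < r) ∧ (c < a → r < a) := by
  induction a, l using turningPointsFrom.induct with
  | case1 a => simp [turningPointsFrom, Alternating]
  | case2 a => simp [turningPointsFrom, Alternating]
  | case3 a b hab => simp [turningPointsFrom, hab, Alternating]
  | case4 a b c l hb ih =>
    rw [turningPointsFrom, if_pos hb]
    obtain ⟨h1, t, h2, h3⟩ := ih
    refine ⟨h1, t, h2, fun r hr c' hc' => ?_⟩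
    obtain rfl : b = c' := by simpa using hc'
    have := h3 r hr c (by simp)
    rcases hb with ⟨h4, h5⟩ | ⟨h4, h5⟩
    · exact ⟨fun h => this.1 (by linarith), fun h => absurd h (not_lt.2 h4)⟩
    · exact ⟨fun h => absurd h (not_lt.2 h5), fun h => this.2 (by linarith)⟩
  | case5 a b c l hb ih =>
    rw [turningPointsFrom, if_neg hb]
    obtain ⟨h1, t, h2, h3⟩ := ih
    rw [h2] at h1 ⊢
    refine ⟨?_, b :: t, rfl, fun r hr c' hc' => ?_⟩
    · match t, h1, h3 with
      | [], _, _ => trivial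
      | r :: t, h1, h3 =>
        refine ⟨?_, h1⟩
        have h4 := h3 r (by simp) c (by simp)
        push Not at hb
        rcases lt_trichotomy a b with h5 | h5 | h5
        · exact Or.inl ⟨h5, h4.2 (hb.1 h5.le)⟩
        · rcases le_total b c with h6 | h6
          · exact absurd (hb.1 h5.le) (not_lt.2 h6)
          · exact absurd (hb.2 h6) (by linarith)
        · refine Or.inr ⟨h5, h4.1 ?_⟩
          by_contra h6
          exact absurd (hb.2 (not_lt.1 h6)) (by linarith)
    · obtain rfl : b = c' := by simpa using hc'
      obtain rfl : b = r := by simpa using hr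
      simp

theorem turningPoints_alternating (l : List ℝ) : Alternating (turningPoints l) := by
  cases l with
  | nil => trivial
  | cons a l => exact (turningPointsFrom_alternating a l).1

theorem trackingCost_turningPoints {h : ℝ} (hh : 0 ≤ h) (l : List ℝ) (y : ℝ) :
    trackingCost h (turningPoints l) y = trackingCost h l y := by
  cases l with
  | nil => rfl
  | cons a l => exact trackingCost_turningPointsFrom hh a l y

/-! ### Extraction of full cycles -/

/-- No four successive points satisfy the four-point test. -/
def NoCycle (l : List ℝ) : Prop :=
  ∀ a b c d : ℝ, [a, b, c, d] <:+: l → ¬ (|b - c| ≤ |a - b| ∧ |b - c| ≤ |c - d|)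

theorem NoCycle.tail {a : ℝ} {l : List ℝ} (H : NoCycle (a :: l)) : NoCycle l :=
  fun _ _ _ _ h => H _ _ _ _ (h.trans (List.suffix_cons a l).isInfix)

theorem NoCycle.head {a b c d : ℝ} {l : List ℝ} (H : NoCycle (a :: b :: c :: d :: l)) :
    ¬ (|b - c| ≤ |a - b| ∧ |b - c| ≤ |c - d|) :=
  H a b c d ⟨[], l, by simp⟩

/-- The four-point test is invariant under time reversal; the kept points are stored latest first.
-/
theorem NoCycle.reverse {l : List ℝ} (H : NoCycle l) : NoCycle l.reverse := by
  intro a b c d h hc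
  have h' : [d, c, b, a] <:+: l := by
    have := List.reverse_infix.2 h
    simpa using this
  refine H d c b a h' ?_
  rw [abs_sub_comm c b, abs_sub_comm d c, abs_sub_comm b a]
  exact ⟨hc.2, hc.1⟩

theorem NoCycle.cons {a b c d : ℝ} {l : List ℝ} (H : NoCycle (b :: c :: d :: l))
    (h : ¬ (|b - c| ≤ |a - b| ∧ |b - c| ≤ |c - d|)) : NoCycle (a :: b :: c :: d :: l) := by
  intro a' b' c' d' hi
  rcases List.infix_cons_iff.1 hi with hp | hp
  · simp only [List.cons_prefix_cons] at hp
    obtain ⟨rfl, rfl, rfl, rfl, -⟩ := hp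
    exact h
  · exact H _ _ _ _ hp

theorem noCycle_of_length {l : List ℝ} (h : l.length < 4) : NoCycle l := by
  intro a b c d hi
  have := hi.length_le
  simp at this
  omega

theorem alternating_cycle {a b c d : ℝ} {l : List ℝ} (H : Alternating (a :: b :: c :: d :: l))
    (h : |b - c| ≤ |a - b| ∧ |b - c| ≤ |c - d|) :
    (a < b ∧ c < b ∧ a ≤ c ∧ b ≤ d) ∨ (b < a ∧ b < c ∧ c ≤ a ∧ d ≤ b) := by
  obtain ⟨h1, h2, -⟩ := H
  obtain ⟨h3, h4⟩ := h
  rcases h1 with ⟨h5, h6⟩ | ⟨h5, h6⟩ <;> rcases h2 with ⟨h7, h8⟩ | ⟨h7, h8⟩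
  · exact absurd h6 (not_lt.2 h7.le)
  · rw [abs_of_pos (by linarith), abs_of_neg (by linarith)] at h3 h4
    exact Or.inl ⟨h5, h6, by linarith, by linarith⟩
  · rw [abs_of_neg (by linarith), abs_of_pos (by linarith)] at h3 h4
    exact Or.inr ⟨h5, h6, by linarith, by linarith⟩
  · exact absurd h6 (not_lt.2 h7.le)

/-- Since `b` and `c` lie between `a` and `d`, the new neighbour `d` of `a` is on the same side as
`b` was, and `a` is on the same side of `d` as `c` was. -/
theorem Alternating.remove {a b c d : ℝ} {p l : List ℝ}
    (H : Alternating (p ++ a :: b :: c :: d :: l))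
    (h : |b - c| ≤ |a - b| ∧ |b - c| ≤ |c - d|) : Alternating (p ++ a :: d :: l) := by
  have hc := alternating_cycle H.of_append h
  induction p with
  | nil =>
    cases l with
    | nil => trivial
    | cons e l =>
      obtain ⟨h1, h2, h3, h4⟩ := H
      refine ⟨?_, h4⟩
      rcases hc with hc | hc <;> rcases h3 with h3 | h3
      · exact Or.inl ⟨by linarith, h3.2⟩
      · exact absurd h3.1 (by linarith)
      · exact absurd h3.1 (by linarith)
      · exact Or.inr ⟨by linarith, h3.2⟩
  | cons e p ih =>
    have ih := ih H.tail
    match p, H, ih with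
    | [], H, ih =>
      refine ⟨?_, ih⟩
      rcases H.1 with h1 | h1 <;> rcases hc with hc | hc
      · exact absurd h1.2 (by linarith)
      · exact Or.inl ⟨h1.1, by linarith⟩
      · exact Or.inr ⟨h1.1, by linarith⟩
      · exact absurd h1.2 (by linarith)
    | [f], H, ih => exact ⟨H.1, ih⟩
    | f :: g :: p, H, ih => exact ⟨H.1, ih⟩

/-- The loop invariant of the scan. Cost and alternation concern kept and unread points together;
the absence of cycles concerns the kept points only. -/
theorem extract_spec {h : ℝ} (hh : 0 ≤ h) (d : ℝ) (kept s : List ℝ)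
    (HA : Alternating (kept.reverse ++ d :: s)) (HN : NoCycle kept) :
    (∀ y, trackingCost h (kept.reverse ++ d :: s) y =
      2 * ((extract d kept).1.map (hinge h)).sum +
        trackingCost h ((extract d kept).2.reverse ++ s) y) ∧
      Alternating ((extract d kept).2.reverse ++ s) ∧ NoCycle (extract d kept).2 := by
  induction kept using extract.induct (d := d) with
  | case1 c b a l hc ih =>
    rw [extract, if_pos hc]
    have e : (c :: b :: a :: l).reverse ++ d :: s = l.reverse ++ a :: b :: c :: d :: s := by simp
    have e' : (a :: l).reverse ++ d :: s = l.reverse ++ a :: d :: s := by simp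
    rw [e] at HA
    rw [e'] at ih
    obtain ⟨h1, h2, h3⟩ := ih (HA.remove hc) HN.tail.tail
    refine ⟨fun y => ?_, h2, h3⟩
    rw [e, trackingCost_append_congr (trackingCost_cycle hh (alternating_cycle HA.of_append hc) s),
      h1]
    simp only [List.map_cons, List.sum_cons]
    ring
  | case2 c b a l hc =>
    rw [extract, if_neg hc]
    refine ⟨fun y => by simp, by simpa using HA, HN.cons ?_⟩
    rw [abs_sub_comm c b, abs_sub_comm d c, abs_sub_comm b a]
    tauto
  | case3 l hl =>
    have hl3 : l.length < 3 := by
      match l, hl with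
      | [], _ => simp
      | [_], _ => simp
      | [_, _], _ => simp
      | c :: b :: a :: l, hl => exact (hl c b a l rfl).elim
    have e : extract d l = ([], d :: l) := by
      match l, hl3 with
      | [], _ => rfl
      | [_], _ => rfl
      | [_, _], _ => rfl
    rw [e]
    exact ⟨fun y => by simp, by simpa using HA, noCycle_of_length (by rw [List.length_cons]; omega)⟩

theorem scan_spec {h : ℝ} (hh : 0 ≤ h) (s kept : List ℝ)
    (HA : Alternating (kept.reverse ++ s)) (HN : NoCycle kept) :
    (∀ y, trackingCost h (kept.reverse ++ s) y =
      2 * ((scan kept s).1.map (hinge h)).sum + trackingCost h (scan kept s).2.reverse y) ∧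
      Alternating (scan kept s).2.reverse ∧ NoCycle (scan kept s).2 := by
  induction s generalizing kept with
  | nil => simpa [scan] using ⟨by simpa using HA, HN⟩
  | cons d s ih =>
    obtain ⟨h1, h2, h3⟩ := extract_spec hh d kept s HA HN
    obtain ⟨h4, h5, h6⟩ := ih _ h2 h3
    refine ⟨fun y => ?_, h5, h6⟩
    rw [h1, h4, scan]
    simp only [List.map_append, List.sum_append]
    ring

/-! ### The residue -/

/-- The sum of `φ` over the distances of consecutive points. -/
noncomputable def stepSum (φ : ℝ → ℝ) : List ℝ → ℝ
  | a :: b :: l => φ |a - b| + stepSum φ (b :: l)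
  | _ => 0

theorem stepSum_le_trackingCost {h : ℝ} (hh : 0 ≤ h) (l : List ℝ) (y : ℝ) :
    stepSum (hinge h) l ≤ trackingCost h l y := by
  induction l generalizing y with
  | nil => simp [stepSum, trackingCost]
  | cons a l ih =>
    cases l with
    | nil => simp [stepSum, trackingCost]
    | cons b l =>
      have h1 := ih (clamp h a y)
      obtain ⟨h2, h3⟩ := clamp_mem hh a y
      have h0 := abs_nonneg (y - clamp h a y)
      have hb : trackingCost h (b :: l) (clamp h a y) =
        |clamp h a y - clamp h b (clamp h a y)| + trackingCost h l (clamp h b (clamp h a y)) := rfl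
      have ha : trackingCost h (a :: b :: l) y =
        |y - clamp h a y| + trackingCost h (b :: l) (clamp h a y) := rfl
      have hs : stepSum (hinge h) (a :: b :: l) =
        hinge h |a - b| + stepSum (hinge h) (b :: l) := rfl
      set u := clamp h a y
      obtain ⟨h4, h5⟩ := clamp_mem hh b u
      -- From this start the move at `b` is free, so the bound leaves the move from `u` to pay for
      -- the first hinge.
      have h6 := ih (clamp h b u)
      have h7 : trackingCost h (b :: l) (clamp h b u) = trackingCost h l (clamp h b u) := by
        simp only [trackingCost, clamp_of_mem h4 h5, sub_self, abs_zero, zero_add]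
      have h8 : hinge h |a - b| ≤ |u - clamp h b u| := by
        refine max_le ?_ (abs_nonneg _)
        rcases abs_cases (a - b) with ⟨e, -⟩ | ⟨e, -⟩ <;> rw [e]
        · linarith [le_abs_self (u - clamp h b u)]
        · linarith [neg_abs_le (u - clamp h b u)]
      linarith

/-- Once depths decrease, every later point lies between its two predecessors, so `y` stays within
`h` of all of them and the path never moves. -/
theorem trackingCost_stay {h : ℝ} (l : List ℝ) (a b y : ℝ) (HA : Alternating (a :: b :: l))
    (HN : NoCycle (a :: b :: l)) (hd : ∀ c ∈ l.head?, |b - c| < |a - b|)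
    (ha : |y - a| ≤ h) (hb : |y - b| ≤ h) :
    trackingCost h l y ≤ stepSum (hinge h) (b :: l) := by
  induction l generalizing a b with
  | nil => simp [trackingCost, stepSum]
  | cons c l ih =>
    have hc := hd c (by simp)
    have hyc : |y - c| ≤ h := by
      rw [abs_le] at *
      rcases HA.1 with h1 | h1
      · rw [abs_of_pos (by linarith), abs_of_neg (by linarith)] at hc
        constructor <;> linarith
      · rw [abs_of_neg (by linarith), abs_of_pos (by linarith)] at hc
        constructor <;> linarith
    have := ih b c HA.tail HN.tail (fun d hd' => by
      cases l with
      | nil => simp at hd'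
      | cons e l =>
        obtain rfl : e = d := by simpa using hd'
        have := HN.head
        push Not at this
        exact this hc.le) hb hyc
    have e : clamp h c y = y := by
      rw [abs_le] at hyc
      exact clamp_of_mem (by linarith) (by linarith)
    simp only [trackingCost, e, sub_self, abs_zero, zero_add, stepSum]
    linarith [hinge_nonneg h |b - c|]

/-- This makes the depths of a residue unimodal: a step that does not grow is followed by a smaller
one. -/
theorem decreasing_of_noCycle {a b c : ℝ} {l : List ℝ} (HN : NoCycle (a :: b :: c :: l))
    (h : |b - c| ≤ |a - b|) : ∀ d ∈ l.head?, |c - d| < |b - c| := by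
  intro d hd
  cases l with
  | nil => simp at hd
  | cons e l =>
    obtain rfl : e = d := by simpa using hd
    have := HN.head
    push Not at this
    exact this h

/-- After a step deeper than `2h` the path sits on the edge of the interval of `b` facing `a`. Each
further deep step takes it to the facing edge of the next interval, at exactly the price of the
hinge. The first shallow step begins the decreasing phase, where `trackingCost_stay` applies. -/
theorem trackingCost_moved {h : ℝ} (hh : 0 ≤ h) (l : List ℝ) (a b : ℝ)
    (HA : Alternating (a :: b :: l)) (HN : NoCycle (a :: b :: l)) (hab : 2 * h < |a - b|) :
    (a < b → trackingCost h l (b - h) ≤ stepSum (hinge h) (b :: l)) ∧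
      (b < a → trackingCost h l (b + h) ≤ stepSum (hinge h) (b :: l)) := by
  induction l generalizing a b with
  | nil => simp [trackingCost, stepSum]
  | cons c l ih =>
    rcases le_or_gt |b - c| (2 * h) with hbc | hbc
    · have hd := decreasing_of_noCycle HN (by linarith)
      have hs := fun y => trackingCost_stay (h := h) l b c y HA.tail HN.tail hd
      constructor
      · intro hlt
        have hcb : c < b := by rcases HA.1 with h1 | h1 <;> [exact h1.2; linarith [h1.1]]
        have hbc' := hbc
        rw [abs_of_pos (by linarith)] at hbc'
        have := hs (b - h) (by rw [abs_le]; constructor <;> linarith)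
          (by rw [abs_le]; constructor <;> linarith)
        simp only [trackingCost, clamp_of_mem (h := h) (x := c) (y := b - h) (by linarith)
          (by linarith), sub_self, abs_zero, zero_add, stepSum]
        linarith [hinge_nonneg h |b - c|]
      · intro hlt
        have hcb : b < c := by rcases HA.1 with h1 | h1 <;> [linarith [h1.1]; exact h1.2]
        have hbc' := hbc
        rw [abs_of_neg (by linarith)] at hbc'
        have := hs (b + h) (by rw [abs_le]; constructor <;> linarith)
          (by rw [abs_le]; constructor <;> linarith)
        simp only [trackingCost, clamp_of_mem (h := h) (x := c) (y := b + h) (by linarith)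
          (by linarith), sub_self, abs_zero, zero_add, stepSum]
        linarith [hinge_nonneg h |b - c|]
    · have ih := ih b c HA.tail HN.tail hbc
      have hle : |b - c| - 2 * h ≤ hinge h |b - c| := le_max_left _ _
      constructor
      · intro hlt
        have hcb : c < b := by rcases HA.1 with h1 | h1 <;> [exact h1.2; linarith [h1.1]]
        have := ih.2 hcb
        have e : |b - c| = b - c := abs_of_pos (by linarith)
        rw [e] at hbc hle
        simp only [trackingCost, stepSum]
        rw [clamp_of_gt hh (by linarith), abs_of_nonneg (a := b - h - (c + h)) (by linarith), e]
        linarith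
      · intro hlt
        have hcb : b < c := by rcases HA.1 with h1 | h1 <;> [linarith [h1.1]; exact h1.2]
        have := ih.1 hcb
        have e : |b - c| = c - b := by rw [abs_of_neg (by linarith)]; ring
        rw [e] at hbc hle
        simp only [trackingCost, stepSum]
        rw [clamp_of_lt hh (by linarith), abs_of_nonpos (a := b + h - (c - h)) (by linarith), e]
        linarith

/-- The start is chosen by looking ahead through the shallow initial steps, to the first deep step
or the first decrease. -/
theorem trackingCost_free {h : ℝ} (hh : 0 ≤ h) (l : List ℝ) (a b : ℝ)
    (HA : Alternating (a :: b :: l)) (HN : NoCycle (a :: b :: l)) (hab : |a - b| ≤ 2 * h) :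
    ∃ y, |y - a| ≤ h ∧ |y - b| ≤ h ∧ trackingCost h l y ≤ stepSum (hinge h) (b :: l) := by
  have hm : |(a + b) / 2 - a| ≤ h ∧ |(a + b) / 2 - b| ≤ h := by
    rw [abs_le] at *
    rw [abs_le]
    refine ⟨⟨?_, ?_⟩, ?_, ?_⟩ <;> linarith
  induction l generalizing a b with
  | nil => exact ⟨(a + b) / 2, hm.1, hm.2, by simp [trackingCost, stepSum]⟩
  | cons c l ih =>
    rcases le_or_gt |b - c| (2 * h) with hbc | hbc
    · rcases lt_or_ge |b - c| |a - b| with hlt | hge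
      · refine ⟨(a + b) / 2, hm.1, hm.2, trackingCost_stay _ a b _ HA HN (fun d hd => ?_) hm.1 hm.2⟩
        obtain rfl : c = d := by simpa using hd
        exact hlt
      -- As the depth does not shrink, `a` lies between `b` and `c`, so a start good for these two
      -- is good for `a`.
      · obtain ⟨y, h1, h2, h3⟩ := ih b c HA.tail HN.tail hbc (by
          rw [abs_le] at hbc
          rw [abs_le, abs_le]
          refine ⟨⟨?_, ?_⟩, ?_, ?_⟩ <;> linarith)
        refine ⟨y, ?_, h1, ?_⟩
        · rw [abs_le] at h1 h2 ⊢
          rcases HA.1 with h4 | h4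
          · rw [abs_of_pos (a := b - c) (by linarith), abs_of_neg (by linarith)] at hge
            constructor <;> linarith
          · rw [abs_of_neg (a := b - c) (by linarith), abs_of_pos (by linarith)] at hge
            constructor <;> linarith
        · rw [abs_le] at h2
          simp only [trackingCost, clamp_of_mem (h := h) (x := c) (y := y) (by linarith)
            (by linarith), sub_self, abs_zero, zero_add, stepSum]
          linarith [hinge_nonneg h |b - c|]
    · have hmv := trackingCost_moved hh l b c HA.tail HN.tail hbc
      have hle : |b - c| - 2 * h ≤ hinge h |b - c| := le_max_left _ _
      rcases HA.1 with h4 | h4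
      · have e : |b - c| = b - c := abs_of_pos (by linarith)
        rw [abs_of_neg (by linarith)] at hab
        rw [e] at hbc hle
        -- The edge of the interval of `b` facing `c`; it is within `h` of `a` because the step from
        -- `a` is shallow.
        refine ⟨b - h, ?_, ?_, ?_⟩
        · rw [abs_le]; constructor <;> linarith
        · rw [abs_le]; constructor <;> linarith
        · have := hmv.2 h4.2
          simp only [trackingCost, stepSum]
          rw [clamp_of_gt hh (by linarith), abs_of_nonneg (a := b - h - (c + h)) (by linarith), e]
          linarith
      · have e : |b - c| = c - b := by rw [abs_of_neg (by linarith)]; ring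
        rw [abs_of_pos (by linarith)] at hab
        rw [e] at hbc hle
        refine ⟨b + h, ?_, ?_, ?_⟩
        · rw [abs_le]; constructor <;> linarith
        · rw [abs_le]; constructor <;> linarith
        · have := hmv.1 h4.2
          simp only [trackingCost, stepSum]
          rw [clamp_of_lt hh (by linarith), abs_of_nonpos (a := b + h - (c - h)) (by linarith), e]
          linarith

theorem exists_trackingCost_le_stepSum {h : ℝ} (hh : 0 ≤ h) (l : List ℝ) (HA : Alternating l)
    (HN : NoCycle l) : ∃ y, trackingCost h l y ≤ stepSum (hinge h) l := by
  match l, HA, HN with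
  | [], _, _ => exact ⟨0, by simp [trackingCost, stepSum]⟩
  | [a], _, _ =>
    exact ⟨a, by simp [trackingCost, stepSum, clamp_of_mem (x := a) (y := a) (h := h)
      (by linarith) (by linarith)]⟩
  | a :: b :: l, HA, HN =>
    rcases le_or_gt |a - b| (2 * h) with hab | hab
    · obtain ⟨y, h1, h2, h3⟩ := trackingCost_free hh l a b HA HN hab
      refine ⟨y, ?_⟩
      rw [abs_le] at h1 h2
      simp only [trackingCost, clamp_of_mem (h := h) (x := a) (y := y) (by linarith)
        (by linarith), clamp_of_mem (h := h) (x := b) (y := y) (by linarith)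
        (by linarith), sub_self, abs_zero, zero_add, stepSum]
      linarith [hinge_nonneg h |a - b|]
    · have hmv := trackingCost_moved hh l a b HA HN hab
      have hle : |a - b| - 2 * h ≤ hinge h |a - b| := le_max_left _ _
      rcases lt_or_ge a b with hlt | hge
      · have e : |a - b| = b - a := by rw [abs_of_neg (by linarith)]; ring
        rw [e] at hab hle
        -- Starting on the edge facing `b` makes the first move cost exactly `b - a - 2h`.
        refine ⟨a + h, ?_⟩
        have := hmv.1 hlt
        simp only [trackingCost, stepSum]
        rw [clamp_of_mem (x := a) (by linarith) (by linarith), clamp_of_lt hh (by linarith),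
          abs_of_nonpos (a := a + h - (b - h)) (by linarith), e]
        simp only [sub_self, abs_zero]
        linarith
      · have e : |a - b| = a - b := abs_of_nonneg (by linarith)
        rw [e] at hab hle
        refine ⟨a - h, ?_⟩
        have := hmv.2 (by linarith)
        simp only [trackingCost, stepSum]
        rw [clamp_of_mem (x := a) (by linarith) (by linarith), clamp_of_gt hh (by linarith),
          abs_of_nonneg (a := a - h - (b + h)) (by linarith), e]
        simp only [sub_self, abs_zero]
        linarith

/-! ### Convexity of the cost -/

theorem sum_steps {φ : ℝ → ℝ} (h0 : φ 0 = 0) (l : List ℝ) :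
    ((chargingSteps l).map φ).sum + ((dischargingSteps l).map φ).sum = stepSum φ l := by
  induction l with
  | nil => simp [chargingSteps, dischargingSteps, stepSum]
  | cons a l ih =>
    cases l with
    | nil => simp [chargingSteps, dischargingSteps, stepSum]
    | cons b l =>
      rw [stepSum, ← ih, chargingSteps, dischargingSteps]
      rcases lt_trichotomy a b with h | h | h
      · rw [if_pos h, if_neg (not_lt.2 h.le), abs_of_neg (by linarith), neg_sub]
        simp only [List.map_cons, List.sum_cons]
        ring
      · rw [if_neg (by linarith), if_neg (by linarith), h, sub_self, abs_zero, h0, zero_add]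
      · rw [if_neg (not_lt.2 h.le), if_pos h, abs_of_pos (by linarith)]
        simp only [List.map_cons, List.sum_cons]
        ring

theorem sum_map_half (φ : ℝ → ℝ) (l : List ℝ) :
    (l.map fun v => φ v / 2).sum = (l.map φ).sum / 2 := by
  induction l with
  | nil => simp
  | cons a l ih => simp only [List.map_cons, List.sum_cons, ih]; ring

theorem two_mul_cost {φ : ℝ → ℝ} (h0 : φ 0 = 0) {n : ℕ} (x : Fin n → ℝ) :
    2 * cost φ x = 2 * ((fullCycles (List.ofFn x)).map φ).sum +
      stepSum φ (residue (List.ofFn x)) := by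
  rw [← sum_steps h0, cost, sum_map_half, sum_map_half, rainflow]
  simp only [List.map_append, List.sum_append]
  ring

theorem trackingCost_eq {h : ℝ} (hh : 0 ≤ h) (l : List ℝ) (y : ℝ) :
    trackingCost h l y = 2 * ((fullCycles l).map (hinge h)).sum + trackingCost h (residue l) y := by
  have := (scan_spec hh (turningPoints l) [] (by simpa using turningPoints_alternating l)
    (noCycle_of_length (by simp))).1 y
  rwa [List.reverse_nil, List.nil_append, trackingCost_turningPoints hh] at this

theorem residue_alternating (l : List ℝ) : Alternating (residue l) :=
  (scan_spec le_rfl (turningPoints l) [] (by simpa using turningPoints_alternating l)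
    (noCycle_of_length (by simp))).2.1

theorem residue_noCycle (l : List ℝ) : NoCycle (residue l) :=
  (scan_spec le_rfl (turningPoints l) [] (by simpa using turningPoints_alternating l)
    (noCycle_of_length (by simp))).2.2.reverse

theorem hinge_zero {h : ℝ} (hh : 0 ≤ h) : hinge h 0 = 0 := by
  rw [hinge, max_eq_right]; linarith

/-- Twice the rainflow cost for a hinge is the least total variation of a path in the tube. -/
theorem isLeast_two_mul_cost_hinge {h : ℝ} (hh : 0 ≤ h) {n : ℕ} (x : Fin n → ℝ) :
    IsLeast (Set.range (trackingCost h (List.ofFn x))) (2 * cost (hinge h) x) := by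
  have hlow : ∀ y, 2 * cost (hinge h) x ≤ trackingCost h (List.ofFn x) y := fun y => by
    rw [two_mul_cost (hinge_zero hh), trackingCost_eq hh]
    linarith [stepSum_le_trackingCost hh (residue (List.ofFn x)) y]
  obtain ⟨y, hy⟩ := exists_trackingCost_le_stepSum hh _ (residue_alternating (List.ofFn x))
    (residue_noCycle (List.ofFn x))
  refine ⟨⟨y, le_antisymm ?_ (hlow y)⟩, by rintro _ ⟨y, rfl⟩; exact hlow y⟩
  rw [two_mul_cost (hinge_zero hh), trackingCost_eq hh]
  linarith

theorem convexOn_cost_hinge {h : ℝ} (hh : 0 ≤ h) (n : ℕ) :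
    ConvexOn ℝ Set.univ (fun x : Fin n → ℝ => cost (hinge h) x) := by
  refine ⟨convex_univ, fun x _ x' _ a b ha hb hab => ?_⟩
  obtain ⟨y, hy⟩ := (isLeast_two_mul_cost_hinge hh x).1
  obtain ⟨y', hy'⟩ := (isLeast_two_mul_cost_hinge hh x').1
  have h1 := (isLeast_two_mul_cost_hinge hh (a • x + b • x')).2 ⟨a * y + b * y', rfl⟩
  have h2 := trackingCost_ofFn_convex hh ha hb hab x x' y y'
  rw [hy, hy'] at h2
  simp only [smul_eq_mul]
  linarith

/-- All half cycle depths of a profile. -/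
noncomputable def depths (l : List ℝ) : List ℝ := (rainflow l).1 ++ (rainflow l).2

theorem cost_eq_depths (φ : ℝ → ℝ) {n : ℕ} (x : Fin n → ℝ) :
    cost φ x = ((depths (List.ofFn x)).map fun v => φ v / 2).sum := by
  rw [cost, depths, List.map_append, List.sum_append]

theorem extract_nonneg (d : ℝ) (kept : List ℝ) : ∀ v ∈ (extract d kept).1, 0 ≤ v := by
  fun_induction extract d kept with
  | case1 c b a l hc ih => simpa using ih
  | case2 c b a l hc => simp
  | case3 l hl => simp

theorem scan_nonneg (kept s : List ℝ) : ∀ v ∈ (scan kept s).1, 0 ≤ v := by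
  induction s generalizing kept with
  | nil => simp [scan]
  | cons d s ih =>
    intro v hv
    rw [scan, List.mem_append] at hv
    exact hv.elim (extract_nonneg d kept v) (ih _ v)

theorem chargingSteps_nonneg (l : List ℝ) : ∀ v ∈ chargingSteps l, 0 ≤ v := by
  fun_induction chargingSteps l with
  | case1 a b l h ih =>
    intro v hv
    rcases List.mem_cons.1 hv with rfl | hv
    · linarith
    · exact ih v hv
  | case2 a b l h ih => exact ih
  | case3 => simp

theorem dischargingSteps_nonneg (l : List ℝ) : ∀ v ∈ dischargingSteps l, 0 ≤ v := by
  fun_induction dischargingSteps l with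
  | case1 a b l h ih =>
    intro v hv
    rcases List.mem_cons.1 hv with rfl | hv
    · linarith
    · exact ih v hv
  | case2 a b l h ih => exact ih
  | case3 => simp

/-- Needed because `Φ` is controlled on `[0, ∞)` only. -/
theorem depths_nonneg (l : List ℝ) : ∀ v ∈ depths l, 0 ≤ v := by
  intro v hv
  simp only [depths, rainflow, List.mem_append] at hv
  rcases hv with (hv | hv) | (hv | hv)
  · exact scan_nonneg _ _ v hv
  · exact chargingSteps_nonneg _ v hv
  · exact scan_nonneg _ _ v hv
  · exact dischargingSteps_nonneg _ v hv

theorem cost_congr {φ ψ : ℝ → ℝ} {n : ℕ} {x : Fin n → ℝ}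
    (h : ∀ v ∈ depths (List.ofFn x), φ v = ψ v) : cost φ x = cost ψ x := by
  rw [cost_eq_depths, cost_eq_depths]
  congr 1
  exact List.map_congr_left fun v hv => by rw [h v hv]

theorem cost_add_smul (φ ψ : ℝ → ℝ) (k : ℝ) {n : ℕ} (x : Fin n → ℝ) :
    cost (fun v => φ v + k * ψ v) x = cost φ x + k * cost ψ x := by
  simp only [cost_eq_depths]
  induction depths (List.ofFn x) with
  | nil => simp
  | cons a l ih => simp only [List.map_cons, List.sum_cons, ih]; ring

/-- On a finite set, a convex nondecreasing function vanishing at zero is a nonnegative combination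
of hinges. The combination is affine from some point `m` on. -/
theorem exists_hinge_interpolation {Φ : ℝ → ℝ} (hΦ : ConvexOn ℝ (Set.Ici 0) Φ)
    (hmono : MonotoneOn Φ (Set.Ici 0)) (h0 : Φ 0 = 0) {K : (ℝ → ℝ) → Prop}
    (hK0 : K fun _ => 0)
    (hK : ∀ g k h, K g → 0 ≤ k → 0 ≤ h → K fun v => g v + k * hinge h v)
    (S : Finset ℝ) (hS : ∀ v ∈ S, 0 ≤ v) :
    ∃ g, K g ∧ ∃ m σ, (m = 0 ∨ m ∈ S) ∧ (∀ v ∈ S, v ≤ m ∧ g v = Φ v) ∧ g m = Φ m ∧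
      ∀ v, m ≤ v → g v = Φ m + σ * (v - m) ∧ g v ≤ Φ v := by
  induction S using Finset.induction_on_max with
  | empty =>
    -- Monotonicity of `Φ` enters only here: the zero function lies below `Φ`.
    refine ⟨fun _ => 0, hK0, 0, 0, Or.inl rfl, by simp, h0.symm, fun v hv => ⟨by simp [h0], ?_⟩⟩
    rw [← h0]
    exact hmono Set.self_mem_Ici hv hv
  | insert M S hM ih =>
    obtain ⟨g, hg, m, σ, hmS, h1, h2, h3⟩ := ih fun v hv => hS v (Finset.mem_insert_of_mem hv)
    have hm : 0 ≤ m := hmS.elim (fun e => e.ge) fun e => hS m (Finset.mem_insert_of_mem e)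
    have hM0 : 0 ≤ M := hS M (Finset.mem_insert_self _ _)
    rcases lt_or_ge m M with hlt | hge
    · have hpos : 0 < M - m := sub_pos.2 hlt
      obtain ⟨h4, h5⟩ := h3 M hlt.le
      -- The hinge with threshold `m = 2 * (m / 2)` vanishes at the old nodes; `k` is the change of
      -- slope at `m` that corrects the value at `M`. It is nonnegative because `g` lies below `Φ`
      -- beyond `m`.
      set k := (Φ M - g M) / (M - m) with hk
      have hk0 : 0 ≤ k := div_nonneg (by linarith) hpos.le
      have hkM : k * (M - m) = Φ M - g M := div_mul_cancel₀ _ hpos.ne'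
      have e1 : ∀ v, v ≤ m → hinge (m / 2) v = 0 := fun v hv => by
        rw [hinge, max_eq_right]; linarith
      have e2 : ∀ v, m ≤ v → hinge (m / 2) v = v - m := fun v hv => by
        rw [hinge, max_eq_left] <;> linarith
      have hgM : g M + k * hinge (m / 2) M = Φ M := by rw [e2 M hlt.le, hkM]; ring
      refine ⟨_, hK g k (m / 2) hg hk0 (by linarith), M, σ + k,
        Or.inr (Finset.mem_insert_self _ _), ?_, hgM, ?_⟩
      · intro v hv
        rcases Finset.mem_insert.1 hv with rfl | hv
        · exact ⟨le_rfl, hgM⟩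
        · refine ⟨(hM v hv).le, ?_⟩
          rw [e1 v (h1 v hv).1, mul_zero, add_zero, (h1 v hv).2]
      · intro v hv
        have hmv : m ≤ v := by linarith
        have h6 : g v + k * hinge (m / 2) v = Φ M + (σ + k) * (v - M) := by
          rw [e2 v hmv, (h3 v hmv).1]
          rw [h4] at hkM
          linarith
        refine ⟨h6, ?_⟩
        rcases hv.eq_or_lt with rfl | hv
        · exact hgM.le
        -- The new slope `σ + k` is that of the chord of `Φ` from `m` to `M`, so by convexity the
        -- extension stays below `Φ` beyond `M`.
        · have hs := hΦ.slope_mono_adjacent (x := m) (y := M) (z := v) hm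
            (by simp only [Set.mem_Ici]; linarith) hlt hv
          have hσ : σ + k = (Φ M - Φ m) / (M - m) := by
            rw [eq_div_iff hpos.ne', add_mul, hkM, h4]; ring
          rw [← hσ, le_div_iff₀ (by linarith)] at hs
          simp only [h6]
          linarith
    -- As `M` exceeds all earlier nodes, `M ≤ m` forces `m` to be the default `0`; then `M = 0` and
    -- `g` already fits.
    · have hm0 : m = 0 := hmS.resolve_right fun e => absurd (hM m e) (not_lt.2 hge)
      have hMm : M = m := by linarith
      refine ⟨g, hg, m, σ, Or.inl hm0, fun v hv => ?_, h2, h3⟩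
      rcases Finset.mem_insert.1 hv with rfl | hv
      · exact ⟨hge, by rw [hMm, h2]⟩
      · exact h1 v hv

theorem convexOn_cost {Φ : ℝ → ℝ} (hΦ : ConvexOn ℝ (Set.Ici 0) Φ)
    (hmono : MonotoneOn Φ (Set.Ici 0)) (h0 : Φ 0 = 0) (n : ℕ) :
    ConvexOn ℝ Set.univ (fun x : Fin n → ℝ => cost Φ x) := by
  refine ⟨convex_univ, fun x hx x' hx' a b ha hb hab => ?_⟩
  -- The convexity inequality involves only three profiles; on their depths `Φ` may be replaced by
  -- an interpolant.
  let S : Finset ℝ := (depths (List.ofFn x) ++ depths (List.ofFn x') ++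
    depths (List.ofFn (a • x + b • x'))).toFinset
  obtain ⟨g, hg, m, σ, -, h1, -⟩ := exists_hinge_interpolation hΦ hmono h0
    (K := fun g => ConvexOn ℝ Set.univ (fun x : Fin n → ℝ => cost g x))
    (by
      have : (fun x : Fin n → ℝ => cost (fun _ => 0) x) = fun _ => (0 : ℝ) := by
        funext x
        simp [cost]
      rw [this]
      exact convexOn_const 0 convex_univ)
    (fun g k h hg hk hh => by
      simp only [cost_add_smul]
      exact hg.add ((convexOn_cost_hinge hh n).smul hk))
    S (fun v hv => by
      simp only [S, List.mem_toFinset, List.mem_append] at hv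
      rcases hv with (hv | hv) | hv <;> exact depths_nonneg _ v hv)
  have hmem : ∀ v, (v ∈ depths (List.ofFn x) ∨ v ∈ depths (List.ofFn x')) ∨
      v ∈ depths (List.ofFn (a • x + b • x')) → Φ v = g v := fun v hv =>
    (h1 v (by simpa only [S, List.mem_toFinset, List.mem_append] using hv)).2.symm
  have := hg.2 hx hx' ha hb hab
  simp only at this ⊢
  rwa [cost_congr fun v hv => hmem v (.inl (.inl hv)),
    cost_congr fun v hv => hmem v (.inl (.inr hv)), cost_congr fun v hv => hmem v (.inr hv)]

end Rainflow

/-! ### Convexity of the battery control problem -/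

namespace BatteryProblem

variable {T : ℕ} (p : BatteryProblem T)

/-- The state of charge is affine in the controls; `a + b = 1` absorbs the constant `x₀`. -/
theorem soc_combo {a b : ℝ} (hab : a + b = 1) (z w : (Fin T → ℝ) × (Fin T → ℝ)) :
    p.soc (a • z + b • w) = a • p.soc z + b • p.soc w := by
  funext t
  simp only [soc, Pi.add_apply, Pi.smul_apply, smul_eq_mul, mul_add, Finset.mul_sum]
  have h : p.x₀ = a * p.x₀ + b * p.x₀ := by rw [← add_mul, hab, one_mul]
  rw [add_add_add_comm, ← h, ← Finset.sum_add_distrib]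
  congr 1
  refine Finset.sum_congr rfl fun k _ => ?_
  split_ifs
  · simp only [Prod.fst_add, Prod.snd_add, Prod.smul_fst, Prod.smul_snd, Pi.add_apply,
      Pi.smul_apply, smul_eq_mul]
    ring
  · simp

theorem profile_combo {a b : ℝ} (hab : a + b = 1) (z w : (Fin T → ℝ) × (Fin T → ℝ)) :
    p.profile (a • z + b • w) = a • p.profile z + b • p.profile w := by
  funext t
  exact congrFun (p.soc_combo hab z w) t.succ

theorem convexOn_mul_comp {n : ℕ} {f : (Fin n → ℝ) → ℝ} (hf : ConvexOn ℝ Set.univ f)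
    {B E : ℝ} (hB : 0 ≤ B) (hE : 0 ≤ E) {g : (Fin T → ℝ) × (Fin T → ℝ) → Fin n → ℝ}
    (hg : ∀ a b : ℝ, a + b = 1 → ∀ z w, g (a • z + b • w) = a • g z + b • g w) :
    ConvexOn ℝ Set.univ (fun z => f (g z) * B * E) := by
  refine ⟨convex_univ, fun z _ w _ a b ha hb hab => ?_⟩
  have h := hf.2 (Set.mem_univ (g z)) (Set.mem_univ (g w)) ha hb hab
  rw [← hg a b hab] at h
  simp only [smul_eq_mul] at h ⊢
  have := mul_le_mul_of_nonneg_right (mul_le_mul_of_nonneg_right h hB) hE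
  linarith

theorem convex_feasible : Convex ℝ p.feasible := by
  intro z hz w hw a b ha hb hab t
  have key : ∀ {lo hi u v : ℝ}, lo ≤ u ∧ u ≤ hi → lo ≤ v ∧ v ≤ hi →
      lo ≤ a * u + b * v ∧ a * u + b * v ≤ hi := fun h1 h2 =>
    (convex_Icc _ _) (Set.mem_Icc.2 h1) (Set.mem_Icc.2 h2) ha hb hab
  rw [p.profile_combo hab]
  exact ⟨key (hz t).1 (hw t).1, key (hz t).2.1 (hw t).2.1, key (hz t).2.2 (hw t).2.2⟩

theorem max_combo_le {a b u v s : ℝ} (ha : 0 ≤ a) (hb : 0 ≤ b) (hs : s = a * u + b * v) :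
    max s 0 ≤ a * max u 0 + b * max v 0 := by
  have h1 := mul_le_mul_of_nonneg_left (le_max_left u 0) ha
  have h2 := mul_le_mul_of_nonneg_left (le_max_left v 0) hb
  have h3 := mul_nonneg ha (le_max_right u 0)
  have h4 := mul_nonneg hb (le_max_right v 0)
  exact max_le (by linarith) (by linarith)

theorem convexOn_penalty (hτ : 0 ≤ p.τ) (ho : 0 ≤ p.priceOver) (hu : 0 ≤ p.priceUnder) :
    ConvexOn ℝ Set.univ p.penalty := by
  refine ⟨convex_univ, fun z _ w _ a b ha hb hab => ?_⟩
  simp only [penalty, smul_eq_mul]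
  rw [mul_left_comm a, mul_left_comm b, ← mul_add, Finset.mul_sum (a := a),
    Finset.mul_sum (a := b), ← Finset.sum_add_distrib]
  refine mul_le_mul_of_nonneg_left (Finset.sum_le_sum fun t _ => ?_) hτ
  have hr : p.r t = a * p.r t + b * p.r t := by rw [← add_mul, hab, one_mul]
  have h1 := max_combo_le ha hb (show
    p.ηc * (a • z + b • w).1 t - (a • z + b • w).2 t / p.ηd - p.r t =
      a * (p.ηc * z.1 t - z.2 t / p.ηd - p.r t) + b * (p.ηc * w.1 t - w.2 t / p.ηd - p.r t) by
    simp only [Prod.fst_add, Prod.snd_add, Prod.smul_fst, Prod.smul_snd, Pi.add_apply,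
      Pi.smul_apply, smul_eq_mul]
    linear_combination -hr)
  have h2 := max_combo_le ha hb (show
    p.r t - p.ηc * (a • z + b • w).1 t + (a • z + b • w).2 t / p.ηd =
      a * (p.r t - p.ηc * z.1 t + z.2 t / p.ηd) + b * (p.r t - p.ηc * w.1 t + w.2 t / p.ηd) by
    simp only [Prod.fst_add, Prod.snd_add, Prod.smul_fst, Prod.smul_snd, Pi.add_apply,
      Pi.smul_apply, smul_eq_mul]
    linear_combination hr)
  have h3 := mul_le_mul_of_nonneg_left h1 ho
  have h4 := mul_le_mul_of_nonneg_left h2 hu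
  linarith

end BatteryProblem

theorem theorem1 (Φ : ℝ → ℝ) (hΦ : ConvexOn ℝ (Set.Ici 0) Φ)
    (hΦ_mono : MonotoneOn Φ (Set.Ici 0)) (hΦ_zero : Φ 0 = 0) :
    (∀ n : ℕ, ConvexOn ℝ Set.univ (fun x : Fin n → ℝ => Rainflow.cost Φ x)) ∧
    (∀ (T : ℕ) (p : BatteryProblem T), 0 < p.τ → 0 < p.E → 0 < p.ηc → 0 < p.ηd → 0 ≤ p.B →
      0 ≤ p.priceOver → 0 ≤ p.priceUnder →
      ConvexOn ℝ Set.univ (p.agingCost Φ) ∧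
      ConvexOn ℝ Set.univ (p.agingCostFromInitial Φ) ∧
      Convex ℝ p.feasible ∧
      ConvexOn ℝ Set.univ (fun z => p.penalty z + p.agingCost Φ z) ∧
      ConvexOn ℝ Set.univ (fun z => p.penalty z + p.agingCostFromInitial Φ z)) := by
  have hcost := Rainflow.convexOn_cost hΦ hΦ_mono hΦ_zero
  refine ⟨hcost, fun T p hτ hE _ _ hB ho hu => ?_⟩
  have h1 : ConvexOn ℝ Set.univ (p.agingCost Φ) :=
    BatteryProblem.convexOn_mul_comp (hcost T) hB hE.le fun _ _ hab => p.profile_combo hab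
  have h2 : ConvexOn ℝ Set.univ (p.agingCostFromInitial Φ) :=
    BatteryProblem.convexOn_mul_comp (hcost (T + 1)) hB hE.le fun _ _ hab => p.soc_combo hab
  have h3 := p.convexOn_penalty hτ.le ho hu
  exact ⟨h1, h2, p.convex_feasible, h3.add h1, h3.add h2⟩
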